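/- Let $M$ and $P$ be connected paracompact (Hausdorff, finite-dimensional) smooth manifolds, $G$ a Lie group, and $P(M,G)$ a smooth principal bundle with projection $p:P\to M$, where $G$ acts from the left on $P$. Let $\omega$ be a flat connection on $P(M,G)$, i.e. a connection that is locally isomorphic to the canonical flat connection of a product bundle. For $x\in P$ let $N(x)$ be the maximal horizontal leaf of $\omega$ through $x$ (the total space of the holonomy bundle through $x$), with its leaf topology and its smooth structure as an integral manifold of the horizontal distribution. Let $h_\omega:\pi_1(M,p(x_0))\to G$ be the holonomy morphism based at $x_0\in P$: $h_\omega([w])=g$ when the horizontal lift of the loop $w$ starting at $x_0$ ends at $g\,x_0$. Let $q:\widehat M\to M$ be a smooth covering with $\widehat M$ connected, let $\widehat P=\widehat M\times_M P$ be the induced principal $G$-bundle over $\widehat M$, with projections $\widehat p:\widehat P\to\widehat M$ and $\widehat q:\widehat P\to P$, and let $\widehat\omega=\widehat q^{\,*}\omega$ be the induced flat connection. Let $x_0\in P$ and $\widehat x_0\in\widehat q^{-1}(x_0)$. If $\ker h_\omega\subseteq q_\#\bigl(\pi_1(\widehat M,\widehat p(\widehat x_0))\bigr)$ in $\pi_1(M,p(x_0))$,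 then $\widehat q$ restricts to a diffeomorphism from the maximal horizontal leaf $N(\widehat x_0)$ of $\widehat\omega$ onto the maximal horizontal leaf $N(x_0)$ of $\omega$; in particular $N(\widehat x_0)\cong N(x_0)$. -/

import Mathlib

open scoped Manifold ContDiff Topology

namespace FlatBundle

noncomputable section

open Set Filter

set_option linter.unusedSectionVars false

/-- The charted space structure on `X` pulled back along a local homeomorphism `f : X → Y`: its
charts are the local restrictions of `f` to homeomorphisms, followed by charts of `Y`. -/
@[reducible] def pullbackChartedSpace {X Y H : Type*} [TopologicalSpace X] [TopologicalSpace Y]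
    [TopologicalSpace H] [ChartedSpace H Y] (f : X → Y) (hf : IsLocalHomeomorph f) :
    ChartedSpace H X where
  atlas := {c | ∃ e : OpenPartialHomeomorph X Y, f = e ∧ ∃ c' ∈ atlas H Y, c = e.trans c'}
  chartAt x := (hf x).choose.trans (chartAt H (f x))
  mem_chart_source x := by
    have h := (hf x).choose_spec
    simp only [OpenPartialHomeomorph.trans_source, mem_inter_iff, mem_preimage]
    refine ⟨h.1, ?_⟩
    rw [← h.2]
    exact mem_chart_source H (f x)
  chart_mem_atlas x :=
    ⟨_, (hf x).choose_spec.2, _, chart_mem_atlas H (f x), rfl⟩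

theorem pullbackChartedSpace_isManifold {X Y E : Type*} [TopologicalSpace X]
    [TopologicalSpace Y] [NormedAddCommGroup E] [NormedSpace ℝ E] [ChartedSpace E Y]
    [IsManifold 𝓘(ℝ, E) ∞ Y] (f : X → Y) (hf : IsLocalHomeomorph f) :
    letI : ChartedSpace E X := pullbackChartedSpace f hf
    IsManifold 𝓘(ℝ, E) ∞ X := by
  let _ : ChartedSpace E X := pullbackChartedSpace f hf
  refine isManifold_of_contDiffOn 𝓘(ℝ, E) ∞ X ?_
  rintro c₁ c₂ ⟨e₁, h₁, c₁', hc₁, rfl⟩ ⟨e₂, h₂, c₂', hc₂, rfl⟩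
  have h1 := contMDiffOn_symm_of_mem_maximalAtlas (n := ∞) (I := 𝓘(ℝ, E))
    (IsManifold.subset_maximalAtlas hc₁)
  have h2 := contMDiffOn_of_mem_maximalAtlas (n := ∞) (I := 𝓘(ℝ, E))
    (IsManifold.subset_maximalAtlas hc₂)
  have key : ∀ z ∈ ((e₁.trans c₁').symm.trans (e₂.trans c₂')).source,
      z ∈ c₁'.target ∧ c₁'.symm z ∈ c₂'.source ∧ e₂ (e₁.symm (c₁'.symm z)) = c₁'.symm z := by
    intro z hz
    simp only [OpenPartialHomeomorph.trans_source, OpenPartialHomeomorph.symm_source,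
      OpenPartialHomeomorph.trans_target, mem_inter_iff, mem_preimage,
      OpenPartialHomeomorph.coe_trans_symm, Function.comp_apply] at hz
    have h3 : e₂ (e₁.symm (c₁'.symm z)) = c₁'.symm z := by
      rw [← h₂, h₁]
      exact e₁.right_inv hz.1.2
    exact ⟨hz.1.1, h3 ▸ hz.2.2, h3⟩
  have h3 : ContMDiffOn 𝓘(ℝ, E) 𝓘(ℝ, E) ∞ (c₂' ∘ c₁'.symm)
      ((e₁.trans c₁').symm.trans (e₂.trans c₂')).source :=
    h2.comp (h1.mono fun z hz => (key z hz).1) (fun z hz => (key z hz).2.1)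
  refine (contMDiffOn_iff_contDiffOn.1 h3).congr_mono (fun z hz => ?_) (fun z hz => ?_)
  · simp [(key z (by simpa using hz)).2.2]
  · simpa using hz

/-- For the pulled back smooth structure, `f` is a local diffeomorphism. -/
theorem pullbackChartedSpace_isLocalDiffeomorph {X Y E : Type*} [TopologicalSpace X]
    [TopologicalSpace Y] [NormedAddCommGroup E] [NormedSpace ℝ E] [ChartedSpace E Y]
    [IsManifold 𝓘(ℝ, E) ∞ Y] (f : X → Y) (hf : IsLocalHomeomorph f) :
    letI : ChartedSpace E X := pullbackChartedSpace f hf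
    IsLocalDiffeomorph 𝓘(ℝ, E) 𝓘(ℝ, E) ∞ f := by
  let _ : ChartedSpace E X := pullbackChartedSpace f hf
  have _ : IsManifold 𝓘(ℝ, E) ∞ X := pullbackChartedSpace_isManifold f hf
  intro x
  obtain ⟨e, hx, hfe⟩ := hf x
  have hmem : ∀ c' ∈ atlas E Y, e.trans c' ∈ IsManifold.maximalAtlas 𝓘(ℝ, E) ∞ X := fun c' hc' =>
    IsManifold.subset_maximalAtlas ⟨e, hfe, c', hc', rfl⟩
  refine ⟨⟨e.toPartialEquiv, e.open_source, e.open_target, ?_, ?_⟩, hx, fun y _ => congrFun hfe y⟩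
  · intro y hy
    let c := chartAt E (e y)
    have hc := chart_mem_atlas E (e y)
    have h1 := contMDiffOn_of_mem_maximalAtlas (hmem c hc)
    have h2 := contMDiffOn_symm_of_mem_maximalAtlas (n := ∞) (I := 𝓘(ℝ, E))
      (IsManifold.subset_maximalAtlas hc)
    have hy' : y ∈ (e.trans c).source := by simp [hy, c]
    have h3 : ContMDiffOn 𝓘(ℝ, E) 𝓘(ℝ, E) ∞ (c.symm ∘ (e.trans c)) (e.trans c).source :=
      h2.comp h1 (fun z hz => (e.trans c).map_source hz |>.1)
    have h4 := h3.congr (f₁ := e) (fun z hz => by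
      have : e z ∈ c.source := by simpa using hz.2
      simp [c.left_inv this])
    exact (h4.contMDiffAt ((e.trans c).open_source.mem_nhds hy')).contMDiffWithinAt
  · intro y hy
    let c := chartAt E y
    have hc := chart_mem_atlas E y
    have h1 := contMDiffOn_symm_of_mem_maximalAtlas (hmem c hc)
    have h2 := contMDiffOn_of_mem_maximalAtlas (n := ∞) (I := 𝓘(ℝ, E))
      (IsManifold.subset_maximalAtlas hc)
    have h3 : ContMDiffOn 𝓘(ℝ, E) 𝓘(ℝ, E) ∞ ((e.trans c).symm ∘ c) (c.source ∩ e.target) :=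
      h1.comp (h2.mono inter_subset_left) (fun z hz => by
        have hz1 := hz.1
        have hz2 := hz.2
        simp [c.map_source hz1, c.left_inv hz1, hz2])
    have h4 := h3.congr (f₁ := e.symm) (fun z hz => by simp [c.left_inv hz.1])
    exact (h4.contMDiffAt ((c.open_source.inter e.open_target).mem_nhds
      ⟨mem_chart_source E y, hy⟩)).contMDiffWithinAt

theorem _root_.IsLocalDiffeomorph.contMDiffAt_of_comp {X Y Z E F : Type*} [TopologicalSpace X]
    [TopologicalSpace Y] [TopologicalSpace Z] [NormedAddCommGroup E] [NormedSpace ℝ E]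
    [ChartedSpace E X] [ChartedSpace E Y] [NormedAddCommGroup F] [NormedSpace ℝ F] {H : Type*}
    [TopologicalSpace H] {I : ModelWithCorners ℝ F H} [ChartedSpace H Z]
    {f : X → Y} (hf : IsLocalDiffeomorph 𝓘(ℝ, E) 𝓘(ℝ, E) ∞ f) {g : Z → X} {z : Z} (hg : ContinuousAt g z)
    (hfg : ContMDiffAt I 𝓘(ℝ, E) ∞ (f ∘ g) z) : ContMDiffAt I 𝓘(ℝ, E) ∞ g z := by
  have h := hf (g z)
  have h1 := h.localInverse_contMDiffAt
  have h2 : ContMDiffAt I 𝓘(ℝ, E) ∞ (h.localInverse ∘ (f ∘ g)) z := ContMDiffAt.comp z h1 hfg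
  refine h2.congr_of_eventuallyEq ?_
  filter_upwards [hg.eventually h.localInverse_eventuallyEq_left] with y hy
  exact hy.symm

theorem eventually_eq_of_mfderiv_eq_zero {X Y E F : Type*} [TopologicalSpace X]
    [TopologicalSpace Y] [NormedAddCommGroup E] [NormedSpace ℝ E]
    [ChartedSpace E X] [IsManifold 𝓘(ℝ, E) ∞ X] [NormedAddCommGroup F] [NormedSpace ℝ F] [ChartedSpace F Y]
    [IsManifold 𝓘(ℝ, F) ∞ Y]
    {f : X → Y} {V : Set X} (hV : IsOpen V) (hf : MDifferentiableOn 𝓘(ℝ, E) 𝓘(ℝ, F) f V)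
    (h0 : ∀ x ∈ V, mfderiv 𝓘(ℝ, E) 𝓘(ℝ, F) f x = 0) {x : X} (hx : x ∈ V) :
    ∀ᶠ y in 𝓝 x, f y = f x := by
  let c := chartAt E x
  let d := chartAt F (f x)
  have hfc : ContinuousOn f V := hf.continuousOn
  let W := V ∩ c.source ∩ f ⁻¹' d.source
  have hWo : IsOpen W := by
    have : IsOpen (V ∩ f ⁻¹' d.source) := hfc.isOpen_inter_preimage hV d.open_source
    have := this.inter c.open_source
    convert this using 1
    ext; simp [W]; tauto
  have hxW : x ∈ W := ⟨⟨hx, mem_chart_source E x⟩, mem_chart_source F (f x)⟩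
  have hWt : IsOpen (c '' W) := c.isOpen_image_of_subset_source hWo (fun z hz => hz.1.2)
  obtain ⟨r, hr, hball⟩ := Metric.isOpen_iff.1 hWt (c x) (mem_image_of_mem c hxW)
  let g : E → F := d ∘ f ∘ c.symm
  have hinv : ∀ z ∈ Metric.ball (c x) r, z ∈ c.target ∧ c.symm z ∈ W := by
    intro z hz
    obtain ⟨w, hw, rfl⟩ := hball hz
    exact ⟨c.map_source hw.1.2, by rwa [c.left_inv hw.1.2]⟩
  have hder : ∀ z ∈ Metric.ball (c x) r, HasFDerivAt g (0 : E →L[ℝ] F) z := by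
    intro z hz
    obtain ⟨h1, h2⟩ := hinv z hz
    have a1 : MDifferentiableAt 𝓘(ℝ, E) 𝓘(ℝ, E) c.symm z :=
      mdifferentiableAt_atlas_symm (chart_mem_atlas E x) h1
    have a2 : MDifferentiableAt 𝓘(ℝ, E) 𝓘(ℝ, F) f (c.symm z) :=
      (hf _ h2.1.1).mdifferentiableAt (hV.mem_nhds h2.1.1)
    have a3 : MDifferentiableAt 𝓘(ℝ, F) 𝓘(ℝ, F) d (f (c.symm z)) :=
      mdifferentiableAt_atlas (chart_mem_atlas F (f x)) h2.2
    have b2 := a2.hasMFDerivAt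
    rw [h0 _ h2.1.1] at b2
    have b3 := a3.hasMFDerivAt.comp z (b2.comp z a1.hasMFDerivAt)
    have : HasMFDerivAt 𝓘(ℝ, E) 𝓘(ℝ, F) g z (0 : E →L[ℝ] F) :=
      b3.congr_mfderiv (by ext v; simp; rfl)
    exact this.hasFDerivAt
  have hconst : ∀ z ∈ Metric.ball (c x) r, g z = g (c x) := fun z hz =>
    Metric.isOpen_ball.is_const_of_fderiv_eq_zero (𝕜 := ℝ) (convex_ball _ _).isPreconnected
      (fun w hw => (hder w hw).differentiableAt.differentiableWithinAt)
      (fun w hw => (hder w hw).fderiv) hz (Metric.mem_ball_self hr)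
  have hn : ∀ᶠ y in 𝓝 x, c y ∈ Metric.ball (c x) r :=
    (c.continuousAt (mem_chart_source E x)).eventually (Metric.ball_mem_nhds _ hr)
  filter_upwards [hn, hWo.mem_nhds hxW] with y hy hyW
  have := hconst _ hy
  simp only [g, Function.comp_apply, c.left_inv hyW.1.2, c.left_inv hxW.1.2] at this
  exact d.injOn hyW.2 hxW.2 this

section Definitions

variable {EM EG EP : Type*}
  [NormedAddCommGroup EM] [NormedSpace ℝ EM]
  [NormedAddCommGroup EG] [NormedSpace ℝ EG]
  [NormedAddCommGroup EP] [NormedSpace ℝ EP]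
  {M G P : Type*}
  [TopologicalSpace M] [ChartedSpace EM M]
  [TopologicalSpace G] [ChartedSpace EG G] [Group G]
  [TopologicalSpace P] [ChartedSpace EP P] [IsManifold 𝓘(ℝ, EP) ∞ P] [MulAction G P]

variable (EM EG EP M G P) in
/-- A smooth principal bundle `P(M, G)` with the group `G` acting from the left on the total space
`P`. Local triviality: over a neighbourhood `U` of any given point the maps
`x ↦ (proj x, τ x)` and `(m, g) ↦ g • s m` are mutually inverse smooth maps between
`proj ⁻¹' U` and `U × G` (the second one is visibly equivariant, hence so is the first). -/
structure PrincipalBundle where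
  proj : P → M
  contMDiff_proj : ContMDiff 𝓘(ℝ, EP) 𝓘(ℝ, EM) ∞ proj
  contMDiff_smul : ContMDiff (𝓘(ℝ, EG).prod 𝓘(ℝ, EP)) 𝓘(ℝ, EP) ∞ (fun z : G × P => z.1 • z.2)
  proj_smul : ∀ (g : G) (x : P), proj (g • x) = proj x
  locally_trivial : ∀ m : M, ∃ (U : Set M) (s : M → P) (τ : P → G),
    IsOpen U ∧ m ∈ U ∧
    ContMDiffOn 𝓘(ℝ, EM) 𝓘(ℝ, EP) ∞ s U ∧
    ContMDiffOn 𝓘(ℝ, EP) 𝓘(ℝ, EG) ∞ τ (proj ⁻¹' U) ∧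
    (∀ m' ∈ U, proj (s m') = m') ∧
    (∀ x : P, proj x ∈ U → τ x • s (proj x) = x) ∧
    (∀ m' ∈ U, ∀ g : G, τ (g • s m') = g)

/-- A connection on a principal bundle, given by its connection form: a smooth `1`-form on `P`
with values in the Lie algebra `T₁G` of `G`, which reproduces the generators of the fundamental
vector fields (`A ↦ d/dt exp (t A) • x`) and is equivariant,
`ω (g_* v) = Ad g (ω v)`, where `Ad g` is the derivative of `h ↦ g h g⁻¹` at `1`.
The horizontal subspaces are the kernels of the form. -/
structure Connection (B : PrincipalBundle EM EG EP M G P) where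
  form : (x : P) → TangentSpace 𝓘(ℝ, EP) x →L[ℝ] GroupLieAlgebra 𝓘(ℝ, EG) G
  contMDiff_form : ContMDiff (M' := EG) 𝓘(ℝ, EP).tangent 𝓘(ℝ, EG) ∞
    (fun v : TangentBundle 𝓘(ℝ, EP) P => form v.1 v.2)
  form_fundamental : ∀ (x : P) (A : GroupLieAlgebra 𝓘(ℝ, EG) G),
    form x (mfderiv 𝓘(ℝ, EG) 𝓘(ℝ, EP) (fun g : G => g • x) 1 A) = A
  form_smul : ∀ (g : G) (x : P) (v : TangentSpace 𝓘(ℝ, EP) x),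
    form (g • x) (mfderiv 𝓘(ℝ, EP) 𝓘(ℝ, EP) (fun y : P => g • y) x v) =
      mfderiv 𝓘(ℝ, EG) 𝓘(ℝ, EG) (fun h : G => g * h * g⁻¹) 1 (form x v)

/-- `σ` is a horizontal section of the bundle over the open set `V`: a smooth section all of whose
tangent vectors are annihilated by the connection form. -/
structure Connection.IsHorizontalSection {B : PrincipalBundle EM EG EP M G P} (θ : Connection B)
    (V : Set M) (σ : M → P) : Prop where
  isOpen : IsOpen V
  contMDiffOn : ContMDiffOn 𝓘(ℝ, EM) 𝓘(ℝ, EP) ∞ σ V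
  proj_eq : ∀ m ∈ V, B.proj (σ m) = m
  horizontal : ∀ m ∈ V, ∀ v : TangentSpace 𝓘(ℝ, EM) m,
    θ.form (σ m) (mfderiv 𝓘(ℝ, EM) 𝓘(ℝ, EP) σ m v) = 0

/-- A flat connection: locally it is isomorphic to the canonical flat connection of the product
bundle `U × G`, that is, every point of `M` has a neighbourhood over which there is a horizontal
section `σ` (the trivialization `(m, g) ↦ g • σ m` given by such a section carries the horizontal
subspaces of `U × G`, the tangent spaces of the slices `U × {g}`, to those of the connection). -/
structure FlatConnection (B : PrincipalBundle EM EG EP M G P) extends Connection B where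
  flat : ∀ m : M, ∃ (V : Set M) (σ : M → P), m ∈ V ∧ toConnection.IsHorizontalSection V σ

end Definitions

section Lemmas

variable {EM EG EP : Type*}
  [NormedAddCommGroup EM] [NormedSpace ℝ EM]
  [NormedAddCommGroup EG] [NormedSpace ℝ EG]
  [NormedAddCommGroup EP] [NormedSpace ℝ EP]
  {M G P : Type*}
  [TopologicalSpace M] [ChartedSpace EM M] [IsManifold 𝓘(ℝ, EM) ∞ M]
  [TopologicalSpace G] [ChartedSpace EG G] [Group G] [LieGroup 𝓘(ℝ, EG) ∞ G]
  [TopologicalSpace P] [ChartedSpace EP P] [IsManifold 𝓘(ℝ, EP) ∞ P] [MulAction G P]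
  {B : PrincipalBundle EM EG EP M G P}

namespace PrincipalBundle

theorem exists_smul_eq (B : PrincipalBundle EM EG EP M G P) {x y : P}
    (h : B.proj x = B.proj y) : ∃ g : G, g • x = y := by
  obtain ⟨U, s, τ, -, hm, -, -, -, h2, -⟩ := B.locally_trivial (B.proj x)
  refine ⟨τ y * (τ x)⁻¹, ?_⟩
  have hx := h2 x hm
  have hy := h2 y (h ▸ hm)
  rw [mul_smul]
  nth_rw 2 [← hx]
  rw [inv_smul_smul, h, hy]

theorem smul_left_cancel' (B : PrincipalBundle EM EG EP M G P) {g h : G} {x : P}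
    (hg : g • x = h • x) : g = h := by
  obtain ⟨U, s, τ, -, hm, -, -, -, h2, h3⟩ := B.locally_trivial (B.proj x)
  have hx := h2 x hm
  have e1 := h3 _ hm (g * τ x)
  have e2 := h3 _ hm (h * τ x)
  rw [mul_smul, hx] at e1 e2
  rw [hg, e2] at e1
  exact (mul_right_cancel e1).symm

theorem contMDiff_const_smul (B : PrincipalBundle EM EG EP M G P) (g : G) :
    ContMDiff 𝓘(ℝ, EP) 𝓘(ℝ, EP) ∞ (fun y : P => g • y) :=
  B.contMDiff_smul.comp (contMDiff_const.prodMk contMDiff_id)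

theorem contMDiff_smul_const (B : PrincipalBundle EM EG EP M G P) (x : P) :
    ContMDiff 𝓘(ℝ, EG) 𝓘(ℝ, EP) ∞ (fun g : G => g • x) :=
  B.contMDiff_smul.comp (contMDiff_id.prodMk contMDiff_const)

end PrincipalBundle

namespace Connection

theorem form_mfderiv_smul_const (θ : Connection B) (g : G) (x : P)
    (a : TangentSpace 𝓘(ℝ, EG) g)
    (h : θ.form (g • x) (mfderiv 𝓘(ℝ, EG) 𝓘(ℝ, EP) (fun t : G => t • x) g a) = 0) : a = 0 := by
  have hR : ContMDiff 𝓘(ℝ, EG) 𝓘(ℝ, EG) ∞ (fun t : G => t * g⁻¹) := contMDiff_mul_right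
  have hR' : ContMDiff 𝓘(ℝ, EG) 𝓘(ℝ, EG) ∞ (fun t : G => t * g) := contMDiff_mul_right
  have hcomp : (fun t : G => t • x) = (fun t : G => t • (g • x)) ∘ (fun t : G => t * g⁻¹) := by
    funext t
    simp [← mul_smul]
  have key : ∀ g0 : G, g0 = 1 → ∀ A : EG,
      θ.form (g • x) (mfderiv 𝓘(ℝ, EG) 𝓘(ℝ, EP) (fun t : G => t • (g • x)) g0 A) = A := by
    rintro _ rfl A
    exact θ.form_fundamental (g • x) A
  have d1 := mfderiv_comp_apply g
    (((B.contMDiff_smul_const (g • x)).mdifferentiable (by simp)) (g * g⁻¹))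
    ((hR.mdifferentiable (by simp)) g) a
  rw [hcomp] at h
  have h' := h
  erw [d1, key _ (mul_inv_cancel g)] at h'
  have hid : (fun t : G => t * g) ∘ (fun t : G => t * g⁻¹) = id := by
    funext t; simp
  have d2 := mfderiv_comp_apply g
    ((hR'.mdifferentiable (by simp)) (g * g⁻¹))
    ((hR.mdifferentiable (by simp)) g) a
  rw [hid, mfderiv_id] at d2
  have d3 : a = mfderiv 𝓘(ℝ, EG) 𝓘(ℝ, EG) (fun t : G => t * g) (g * g⁻¹)
    (mfderiv 𝓘(ℝ, EG) 𝓘(ℝ, EG) (fun t : G => t * g⁻¹) g a) := d2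
  rw [d3]
  erw [h']
  exact map_zero _

theorem mfderiv_eq_zero_of_horizontal (θ : Connection B) {E X : Type*} [NormedAddCommGroup E] [NormedSpace ℝ E]
    [TopologicalSpace X] [ChartedSpace E X] {f f' : X → P} {τ : X → G} {x : X}
    (hf : MDifferentiableAt 𝓘(ℝ, E) 𝓘(ℝ, EP) f x) (hτ : MDifferentiableAt 𝓘(ℝ, E) 𝓘(ℝ, EG) τ x)
    (heq : f' =ᶠ[𝓝 x] fun y => τ y • f y)
    (hθ : ∀ v, θ.form (f x) (mfderiv 𝓘(ℝ, E) 𝓘(ℝ, EP) f x v) = 0)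
    (hθ' : ∀ v, θ.form (f' x) (mfderiv 𝓘(ℝ, E) 𝓘(ℝ, EP) f' x v) = 0) :
    mfderiv 𝓘(ℝ, E) 𝓘(ℝ, EG) τ x = 0 := by
  ext v
  apply θ.form_mfderiv_smul_const (τ x) (f x)
  have hs : MDifferentiableAt (𝓘(ℝ, EG).prod 𝓘(ℝ, EP)) 𝓘(ℝ, EP)
    (fun z : G × P => z.1 • z.2) (τ x, f x) := B.contMDiff_smul.mdifferentiable (by simp) _
  have hpair := hτ.prodMk hf
  have d1 := mfderiv_comp_apply x hs hpair v
  have d2 := mfderiv_prod_eq_add_apply hs (v := (mfderiv 𝓘(ℝ, E) (𝓘(ℝ, EG).prod 𝓘(ℝ, EP)) (fun y => (τ y, f y)) x v))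
  have d3 := mfderiv_prodMk hτ hf
  have e0 := hθ' v
  have hx : f' x = τ x • f x := heq.self_of_nhds
  rw [hx] at e0
  rw [heq.mfderiv_eq] at e0
  have d4 : mfderiv 𝓘(ℝ, E) 𝓘(ℝ, EP) (fun y => τ y • f y) x v =
     mfderiv 𝓘(ℝ, EG) 𝓘(ℝ, EP) (fun t : G => t • f x) (τ x) (mfderiv 𝓘(ℝ, E) 𝓘(ℝ, EG) τ x v) +
      mfderiv 𝓘(ℝ, EP) 𝓘(ℝ, EP) (fun y : P => τ x • y) (f x) (mfderiv 𝓘(ℝ, E) 𝓘(ℝ, EP) f x v) := by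
    refine d1.trans (d2.trans ?_)
    rw [d3]
    rfl
  have e1 : θ.form (τ x • f x) (mfderiv 𝓘(ℝ, E) 𝓘(ℝ, EP) (fun y => τ y • f y) x v) = 0 := e0
  rw [d4] at e1
  have e2 : θ.form (τ x • f x) (mfderiv 𝓘(ℝ, EP) 𝓘(ℝ, EP) (fun y : P => τ x • y) (f x)
      (mfderiv 𝓘(ℝ, E) 𝓘(ℝ, EP) f x v)) = 0 := by
    rw [θ.form_smul, hθ v]
    exact map_zero _
  rw [map_add] at e1
  erw [e2, add_zero] at e1
  exact e1

end Connection

namespace Connection.IsHorizontalSection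

variable {θ : Connection B} {V V' W : Set M} {σ σ' : M → P}

theorem mono (h : θ.IsHorizontalSection V σ) (hW : IsOpen W) (hWV : W ⊆ V) :
    θ.IsHorizontalSection W σ :=
  ⟨hW, h.contMDiffOn.mono hWV, fun m hm => h.proj_eq m (hWV hm),
    fun m hm => h.horizontal m (hWV hm)⟩

theorem smul (h : θ.IsHorizontalSection V σ) (g : G) :
    θ.IsHorizontalSection V (fun m => g • σ m) := by
  refine ⟨h.isOpen, (B.contMDiff_const_smul g).comp_contMDiffOn h.contMDiffOn,
    fun m hm => (B.proj_smul g (σ m)).trans (h.proj_eq m hm), fun m hm v => ?_⟩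
  have h1 : MDifferentiableAt 𝓘(ℝ, EM) 𝓘(ℝ, EP) σ m :=
    (h.contMDiffOn.contMDiffAt (h.isOpen.mem_nhds hm)).mdifferentiableAt (by simp)
  have h2 : MDifferentiableAt 𝓘(ℝ, EP) 𝓘(ℝ, EP) (fun y : P => g • y) (σ m) :=
    (B.contMDiff_const_smul g).mdifferentiable (by simp) _
  have h3 := mfderiv_comp_apply m h2 h1 v
  have h4 : θ.form (g • σ m) (mfderiv 𝓘(ℝ, EP) 𝓘(ℝ, EP) (fun y : P => g • y) (σ m)
      (mfderiv 𝓘(ℝ, EM) 𝓘(ℝ, EP) σ m v)) = 0 := by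
    rw [θ.form_smul, h.horizontal m hm v]
    exact map_zero _
  exact (congrArg (θ.form (g • σ m)) h3).trans h4

theorem eventuallyEq (h : θ.IsHorizontalSection V σ) (h' : θ.IsHorizontalSection V' σ')
    {m : M} (hm : m ∈ V) (hm' : m ∈ V') (heq : σ m = σ' m) : σ =ᶠ[𝓝 m] σ' := by
  obtain ⟨U, s, τ, hU, hmU, -, hτ, -, h2, -⟩ := B.locally_trivial m
  set W := V ∩ V' ∩ U with hWdef
  have hW : IsOpen W := (h.isOpen.inter h'.isOpen).inter hU
  have hmW : m ∈ W := ⟨⟨hm, hm'⟩, hmU⟩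
  let t : M → G := fun y => τ (σ' y) * (τ (σ y))⁻¹
  have c1 : ContMDiffOn 𝓘(ℝ, EM) 𝓘(ℝ, EG) ∞ (fun y => τ (σ y)) W :=
    hτ.comp (h.contMDiffOn.mono fun y hy => hy.1.1)
      (fun y hy => by simpa [h.proj_eq y hy.1.1] using hy.2)
  have c2 : ContMDiffOn 𝓘(ℝ, EM) 𝓘(ℝ, EG) ∞ (fun y => τ (σ' y)) W :=
    hτ.comp (h'.contMDiffOn.mono fun y hy => hy.1.2)
      (fun y hy => by simpa [h'.proj_eq y hy.1.2] using hy.2)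
  have ct : ContMDiffOn 𝓘(ℝ, EM) 𝓘(ℝ, EG) ∞ t W := c2.mul c1.inv
  have key : ∀ y ∈ W, σ' y = t y • σ y := by
    intro y hy
    have e1 := h2 (σ y) (by rw [h.proj_eq y hy.1.1]; exact hy.2)
    have e2 := h2 (σ' y) (by rw [h'.proj_eq y hy.1.2]; exact hy.2)
    rw [h.proj_eq y hy.1.1] at e1
    rw [h'.proj_eq y hy.1.2] at e2
    have : (τ (σ y))⁻¹ • σ y = s y := by rw [inv_smul_eq_iff, e1]
    rw [mul_smul, this, e2]
  have hder : ∀ y ∈ W, mfderiv 𝓘(ℝ, EM) 𝓘(ℝ, EG) t y = 0 := by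
    intro y hy
    refine θ.mfderiv_eq_zero_of_horizontal (f := σ) (f' := σ') ?_ ?_ ?_
      (h.horizontal y hy.1.1) (h'.horizontal y hy.1.2)
    · exact (h.contMDiffOn.contMDiffAt (h.isOpen.mem_nhds hy.1.1)).mdifferentiableAt (by simp)
    · exact (ct.contMDiffAt (hW.mem_nhds hy)).mdifferentiableAt (by simp)
    · filter_upwards [hW.mem_nhds hy] with z hz using key z hz
  have _ : IsManifold 𝓘(ℝ, EG) ∞ G := (inferInstance : ContMDiffMul 𝓘(ℝ, EG) ∞ G).toIsManifold
  have hc := eventually_eq_of_mfderiv_eq_zero hW (ct.mdifferentiableOn (by simp)) hder hmW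
  have ht1 : t m = 1 := by simp [t, heq]
  filter_upwards [hc, hW.mem_nhds hmW] with y hy hyW
  rw [key y hyW, hy, ht1, one_smul]

end Connection.IsHorizontalSection

theorem FlatConnection.exists_section (θ : FlatConnection B) (x : P) :
    ∃ (V : Set M) (σ : M → P), B.proj x ∈ V ∧ σ (B.proj x) = x ∧ θ.IsHorizontalSection V σ := by
  obtain ⟨V, σ, hm, hσ⟩ := θ.flat (B.proj x)
  obtain ⟨g, hg⟩ := B.exists_smul_eq (hσ.proj_eq _ hm)
  exact ⟨V, fun m => g • σ m, hm, hg, hσ.smul g⟩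

/-- The total space `P`, to be equipped with the leaf topology of the horizontal foliation of a
flat connection. -/
def LeafSpace {B : PrincipalBundle EM EG EP M G P} (_θ : FlatConnection B) : Type _ := P

namespace LeafSpace

variable {θ : FlatConnection B}

/-- The leaf topology: its basic open sets are the plaques, i.e. the images of the local horizontal
sections. -/
instance : TopologicalSpace (LeafSpace θ) :=
  TopologicalSpace.generateFrom
    {S : Set P | ∃ (V : Set M) (σ : M → P), θ.IsHorizontalSection V σ ∧ S = σ '' V}

instance : MulAction G (LeafSpace θ) := inferInstanceAs (MulAction G P)

variable (θ) in
/-- The bundle projection, on the total space with the leaf topology. -/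
def proj (x : LeafSpace θ) : M := B.proj (x : P)

theorem isOpen_plaque {V : Set M} {σ : M → P} (h : θ.IsHorizontalSection V σ) :
    IsOpen (X := LeafSpace θ) (σ '' V) :=
  TopologicalSpace.isOpen_generateFrom_of_mem ⟨V, σ, h, rfl⟩

theorem continuousOn_section {V : Set M} {σ : M → P} (h : θ.IsHorizontalSection V σ) :
    ContinuousOn (Y := LeafSpace θ) σ V := by
  refine continuousOn_isOpen_of_generateFrom fun S hS => ?_
  obtain ⟨V', σ', h', rfl⟩ := hS
  rw [isOpen_iff_mem_nhds]
  rintro m ⟨hm, m', hm', heq⟩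
  have hmm : m' = m := by
    rw [← h'.proj_eq m' hm', heq]
    exact h.proj_eq m hm
  subst hmm
  filter_upwards [h.isOpen.mem_nhds hm, h'.isOpen.mem_nhds hm', h'.eventuallyEq h hm' hm heq]
    with y hy hy' hyy
  exact ⟨hy, y, hy', hyy⟩

theorem continuous_proj : Continuous (proj θ) := by
  refine ⟨fun W hW => ?_⟩
  rw [isOpen_iff_forall_mem_open]
  intro x hx
  obtain ⟨V, σ, hm, hσx, hσ⟩ := θ.exists_section x
  refine ⟨σ '' (V ∩ W), ?_, isOpen_plaque (hσ.mono (hσ.isOpen.inter hW) inter_subset_left),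
    _, ⟨hm, hx⟩, hσx⟩
  rintro _ ⟨m, hmV, rfl⟩
  have : proj θ (σ m) = m := hσ.proj_eq m hmV.1
  exact (this.symm ▸ hmV.2 : proj θ (σ m) ∈ W)

/-- The projection restricts to a homeomorphism from a plaque onto an open subset of `M`. -/
def plaqueHomeomorph {V : Set M} {σ : M → P} (h : θ.IsHorizontalSection V σ) :
    OpenPartialHomeomorph (LeafSpace θ) M where
  toFun := proj θ
  invFun := σ
  source := σ '' V
  target := V
  map_source' := by
    rintro _ ⟨m, hm, rfl⟩
    exact ((h.proj_eq m hm).symm ▸ hm : B.proj (σ m) ∈ V)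
  map_target' m hm := mem_image_of_mem σ hm
  left_inv' := by
    rintro _ ⟨m, hm, rfl⟩
    exact congrArg σ (h.proj_eq m hm)
  right_inv' m hm := h.proj_eq m hm
  open_source := isOpen_plaque h
  open_target := h.isOpen
  continuousOn_toFun := continuous_proj.continuousOn
  continuousOn_invFun := continuousOn_section h

theorem isLocalHomeomorph_proj : IsLocalHomeomorph (proj θ) := by
  intro x
  obtain ⟨V, σ, hm, hσx, hσ⟩ := θ.exists_section x
  exact ⟨plaqueHomeomorph hσ, ⟨_, hm, hσx⟩, rfl⟩

theorem surjective_proj : Function.Surjective (proj θ) := fun m => by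
  obtain ⟨V, σ, hm, hσ⟩ := θ.flat m
  exact ⟨σ m, hσ.proj_eq m hm⟩

/-- The bundle projection, for the leaf topology on the total space, is a covering map. -/
theorem isQuotientCoveringMap_proj : IsQuotientCoveringMap (proj θ) G where
  toIsQuotientMap := isLocalHomeomorph_proj.isOpenMap.isQuotientMap continuous_proj surjective_proj
  continuous_const_smul g := by
    refine continuous_generateFrom_iff.2 ?_
    rintro _ ⟨V, σ, h, rfl⟩
    convert isOpen_plaque (h.smul g⁻¹) using 1
    ext x
    constructor
    · rintro ⟨m, hm, hx⟩
      exact ⟨m, hm, by simp only [hx]; exact inv_smul_smul g x⟩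
    · rintro ⟨m, hm, rfl⟩
      exact ⟨m, hm, (smul_inv_smul g (σ m)).symm⟩
  apply_eq_iff_mem_orbit {x y} := by
    constructor
    · intro h
      obtain ⟨g, hg⟩ := B.exists_smul_eq (x := (y : P)) (y := (x : P)) h.symm
      exact ⟨g, hg⟩
    · rintro ⟨g, rfl⟩
      exact B.proj_smul g y
  disjoint x := by
    obtain ⟨V, σ, hm, hσx, hσ⟩ := θ.exists_section x
    refine ⟨σ '' V, (isOpen_plaque hσ).mem_nhds ⟨_, hm, hσx⟩, ?_⟩
    rintro g ⟨_, ⟨_, ⟨m, hmV, rfl⟩, rfl⟩, m', hm', heq⟩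
    have heq' : σ m' = g • σ m := heq
    have h1 : m' = m := by
      rw [← hσ.proj_eq m' hm', heq', B.proj_smul, hσ.proj_eq m hmV]
    subst h1
    exact (B.smul_left_cancel' (g := g) (h := 1) (x := σ m') (by rw [one_smul]; exact heq'.symm))

/-- The leaves are integral manifolds of the horizontal distribution; their smooth structure is the
one for which the projection to `M` is a local diffeomorphism. -/
instance : ChartedSpace EM (LeafSpace θ) :=
  pullbackChartedSpace (proj θ) isLocalHomeomorph_proj

instance : IsManifold 𝓘(ℝ, EM) ∞ (LeafSpace θ) :=
  pullbackChartedSpace_isManifold (proj θ) isLocalHomeomorph_proj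

/-- A differentiable map into `P` whose tangent vectors are horizontal is continuous for the leaf
topology. In particular the horizontal lift of a smooth path, in the sense of tangent vectors, is
its lift that is continuous for the leaf topology. -/
theorem continuousAt_of_horizontal {E X : Type*} [NormedAddCommGroup E] [NormedSpace ℝ E]
    [TopologicalSpace X] [ChartedSpace E X] [IsManifold 𝓘(ℝ, E) ∞ X] {f : X → P} {W : Set X}
    (hW : IsOpen W) (hf : MDifferentiableOn 𝓘(ℝ, E) 𝓘(ℝ, EP) f W)
    (hθ : ∀ y ∈ W, ∀ v, θ.form (f y) (mfderiv 𝓘(ℝ, E) 𝓘(ℝ, EP) f y v) = 0) {x : X} (hx : x ∈ W) :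
    ContinuousAt (Y := LeafSpace θ) f x := by
  obtain ⟨V, σ, hm, hσx, hσ⟩ := θ.exists_section (f x)
  obtain ⟨U, s, τ, hU, hmU, -, hτ, -, h2, -⟩ := B.locally_trivial (B.proj (f x))
  have hpf : ContinuousOn (fun y => B.proj (f y)) W :=
    B.contMDiff_proj.continuous.comp_continuousOn hf.continuousOn
  set S := W ∩ (fun y => B.proj (f y)) ⁻¹' (V ∩ U) with hSdef
  have hS : IsOpen S := hpf.isOpen_inter_preimage hW (hσ.isOpen.inter hU)
  have hxS : x ∈ S := ⟨hx, hm, hmU⟩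
  let f₀ : X → P := fun y => σ (B.proj (f y))
  let t : X → G := fun y => τ (f y) * (τ (f₀ y))⁻¹
  have dτ : ∀ z : P, B.proj z ∈ U → MDifferentiableAt 𝓘(ℝ, EP) 𝓘(ℝ, EG) τ z := fun z hz =>
    (hτ.contMDiffAt ((hU.preimage B.contMDiff_proj.continuous).mem_nhds hz)).mdifferentiableAt
      (by simp)
  have df : ∀ y ∈ S, MDifferentiableAt 𝓘(ℝ, E) 𝓘(ℝ, EP) f y := fun y hy =>
    (hf y hy.1).mdifferentiableAt (hW.mem_nhds hy.1)
  have dp : ∀ y ∈ S, MDifferentiableAt 𝓘(ℝ, E) 𝓘(ℝ, EM) (fun y => B.proj (f y)) y := fun y hy =>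
    (B.contMDiff_proj.mdifferentiable (by simp) (f y)).comp y (df y hy)
  have dσ : ∀ y ∈ S, MDifferentiableAt 𝓘(ℝ, EM) 𝓘(ℝ, EP) σ (B.proj (f y)) := fun y hy =>
    (hσ.contMDiffOn.contMDiffAt (hσ.isOpen.mem_nhds hy.2.1)).mdifferentiableAt (by simp)
  have df₀ : ∀ y ∈ S, MDifferentiableAt 𝓘(ℝ, E) 𝓘(ℝ, EP) f₀ y := fun y hy =>
    (dσ y hy).comp y (dp y hy)
  have hp₀ : ∀ y ∈ S, B.proj (f₀ y) = B.proj (f y) := fun y hy => hσ.proj_eq _ hy.2.1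
  have dt : ∀ y ∈ S, MDifferentiableAt 𝓘(ℝ, E) 𝓘(ℝ, EG) t y := by
    intro y hy
    have c1 : MDifferentiableAt 𝓘(ℝ, E) 𝓘(ℝ, EG) (fun y => τ (f y)) y :=
      (dτ (f y) hy.2.2).comp y (df y hy)
    have c2 : MDifferentiableAt 𝓘(ℝ, E) 𝓘(ℝ, EG) (fun y => τ (f₀ y)) y :=
      (dτ (f₀ y) ((hp₀ y hy).symm ▸ hy.2.2)).comp y (df₀ y hy)
    have hdiv : MDifferentiableAt (𝓘(ℝ, EG).prod 𝓘(ℝ, EG)) 𝓘(ℝ, EG)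
        (fun z : G × G => z.1 * z.2⁻¹) (τ (f y), τ (f₀ y)) :=
      ((contMDiff_fst (n := ∞)).mul (contMDiff_snd (n := ∞)).inv).mdifferentiable (by simp) _
    exact hdiv.comp y (c1.prodMk c2)
  have key : ∀ y ∈ S, f y = t y • f₀ y := by
    intro y hy
    have e1 := h2 (f₀ y) (by rw [hp₀ y hy]; exact hy.2.2)
    have e2 := h2 (f y) hy.2.2
    rw [hp₀ y hy] at e1
    have : (τ (f₀ y))⁻¹ • f₀ y = s (B.proj (f y)) := by rw [inv_smul_eq_iff, e1]
    rw [mul_smul, this, e2]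
  have hder : ∀ y ∈ S, mfderiv 𝓘(ℝ, E) 𝓘(ℝ, EG) t y = 0 := by
    intro y hy
    refine θ.mfderiv_eq_zero_of_horizontal (df₀ y hy) (dt y hy) ?_ ?_ (hθ y hy.1)
    · filter_upwards [hS.mem_nhds hy] with z hz using key z hz
    · intro v
      have h3 := mfderiv_comp_apply y (dσ y hy) (dp y hy) v
      exact (congrArg (θ.form (f₀ y)) h3).trans (hσ.horizontal _ hy.2.1 _)
  have _ : IsManifold 𝓘(ℝ, EG) ∞ G := (inferInstance : ContMDiffMul 𝓘(ℝ, EG) ∞ G).toIsManifold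
  have hc := eventually_eq_of_mfderiv_eq_zero hS
    (fun y hy => (dt y hy).mdifferentiableWithinAt) hder hxS
  have ht1 : t x = 1 := by simp [t, f₀, hσx]
  have h4 : ContinuousAt (Y := LeafSpace θ) σ (B.proj (f x)) :=
    (continuousOn_section hσ).continuousAt (hσ.isOpen.mem_nhds hm)
  have h5 : ContinuousAt (Y := LeafSpace θ) f₀ x :=
    ContinuousAt.comp (Y := M) (Z := LeafSpace θ) (f := fun y => B.proj (f y)) h4
      (hpf.continuousAt (hW.mem_nhds hx))
  refine h5.congr ?_
  filter_upwards [hc, hS.mem_nhds hxS] with y hy hyS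
  rw [key y hyS, hy, ht1, one_smul]

end LeafSpace

namespace FlatConnection

/-- The maximal horizontal leaf `N(x)` through `x`: the path component of `x` for the leaf topology,
with its leaf topology and its smooth structure (as an open submanifold of the leaf space). -/
def leaf (θ : FlatConnection B) (x : P) : TopologicalSpace.Opens (LeafSpace θ) where
  carrier := pathComponent (X := LeafSpace θ) x
  is_open' := by
    have : LocallyPathConnectedSpace (LeafSpace θ) := ChartedSpace.locallyPathConnectedSpace EM _
    exact IsOpen.pathComponent (X := LeafSpace θ) x

/-- The holonomy morphism `h_ω` with base point `x`. It sends the class of a loop `w` at `proj x`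
to the unique `g` for which the horizontal lift of `w` starting at `x` ends at `g • x`; the
horizontal lift is the lift of `w` along which one stays in the leaf, i.e. the one that is
continuous for the leaf topology. The target is the opposite group because the product `a * b` in
`FundamentalGroup` is the class of the loop that runs through `b` first. -/
def holonomy (θ : FlatConnection B) (x : P) : FundamentalGroup M (B.proj x) →* Gᵐᵒᵖ :=
  (LeafSpace.isQuotientCoveringMap_proj (θ := θ)).fundamentalGroupToMulOpposite
    (⟨x, rfl⟩ : LeafSpace.proj θ ⁻¹' {B.proj x})

end FlatConnection

variable {M' : Type*} [TopologicalSpace M'] [ChartedSpace EM M'] [IsManifold 𝓘(ℝ, EM) ∞ M']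

variable (EM M M') in
/-- A smooth covering `(M', q, M)` of the manifold `M`. -/
structure SmoothCovering where
  toFun : M' → M
  isCoveringMap : IsCoveringMap toFun
  isLocalDiffeomorph : IsLocalDiffeomorph 𝓘(ℝ, EM) 𝓘(ℝ, EM) ∞ toFun

/-- The total space of the bundle induced from `P(M, G)` over the covering `(M', q, M)`: the fibre
product of `M'` and `P` over `M`. -/
@[ext]
structure InducedSpace (B : PrincipalBundle EM EG EP M G P) (q : SmoothCovering EM M M') where
  proj : M'
  toTotal : P
  toFun_proj : q.toFun proj = B.proj toTotal

namespace InducedSpace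

variable {q : SmoothCovering EM M M'}

/-- The topology as a subspace of `M' × P`. -/
instance : TopologicalSpace (InducedSpace B q) :=
  TopologicalSpace.induced (fun z => (z.proj, z.toTotal)) inferInstance

instance : MulAction G (InducedSpace B q) where
  smul g z := ⟨z.proj, g • z.toTotal, z.toFun_proj.trans (B.proj_smul g z.toTotal).symm⟩
  one_smul z := InducedSpace.ext rfl (one_smul G z.toTotal)
  mul_smul g h z := InducedSpace.ext rfl (mul_smul g h z.toTotal)

theorem continuous_pair : Continuous (fun z : InducedSpace B q => (z.proj, z.toTotal)) :=
  continuous_induced_dom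

theorem continuous_proj : Continuous (proj (B := B) (q := q)) := continuous_pair.fst

theorem continuous_toTotal : Continuous (toTotal (B := B) (q := q)) := continuous_pair.snd

theorem continuous_iff {Z : Type*} [TopologicalSpace Z] {f : Z → InducedSpace B q} {z : Z} :
    ContinuousAt f z ↔ ContinuousAt (fun y => proj (f y)) z ∧
      ContinuousAt (fun y => toTotal (f y)) z := by
  refine ⟨fun h => ⟨continuous_proj.continuousAt.comp h, continuous_toTotal.continuousAt.comp h⟩,
    fun h => ?_⟩
  exact (Topology.IsInducing.induced _).continuousAt_iff.2 (h.1.prodMk h.2)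

open Classical in
theorem isLocalHomeomorph_toTotal : IsLocalHomeomorph (toTotal (B := B) (q := q)) := by
  intro z
  obtain ⟨e, hz, he⟩ := q.isCoveringMap.isLocalHomeomorph (proj z)
  have hinv : ∀ x : P, B.proj x ∈ e.target → q.toFun (e.symm (B.proj x)) = B.proj x := by
    intro x hx
    rw [he]
    exact e.right_inv hx
  refine ⟨{ toFun := toTotal
            invFun := fun x => if h : B.proj x ∈ e.target then
              ⟨e.symm (B.proj x), x, hinv x h⟩ else z
            source := proj ⁻¹' e.source
            target := B.proj ⁻¹' e.target
            map_source' := ?_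
            map_target' := ?_
            left_inv' := ?_
            right_inv' := ?_
            open_source := e.open_source.preimage continuous_proj
            open_target := e.open_target.preimage B.contMDiff_proj.continuous
            continuousOn_toFun := continuous_toTotal.continuousOn
            continuousOn_invFun := ?_ }, hz, rfl⟩
  · intro y hy
    have := e.map_source hy
    rw [← he, toFun_proj] at this
    exact this
  · intro x hx
    have hx' : B.proj x ∈ e.target := hx
    simp only [dif_pos hx']
    exact e.map_target hx'
  · intro y hy
    have h1 : B.proj (toTotal y) = e (proj y) := by rw [← toFun_proj, he]
    have h2 : B.proj (toTotal y) ∈ e.target := h1 ▸ e.map_source hy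
    simp only [dif_pos h2]
    refine InducedSpace.ext ?_ rfl
    change e.symm (B.proj (toTotal y)) = proj y
    rw [h1]
    exact e.left_inv hy
  · intro x hx
    have hx' : B.proj x ∈ e.target := hx
    simp only [dif_pos hx']
  · intro x hx
    have hx' : B.proj x ∈ e.target := hx
    have hn : ∀ᶠ y in 𝓝 x, B.proj y ∈ e.target :=
      B.contMDiff_proj.continuous.continuousAt.eventually (e.open_target.mem_nhds hx')
    refine (continuous_iff.2 ⟨?_, ?_⟩).continuousWithinAt
    · have h1 : ContinuousAt (fun y => e.symm (B.proj y)) x :=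
        (e.continuousAt_symm hx').comp B.contMDiff_proj.continuous.continuousAt
      refine h1.congr ?_
      filter_upwards [hn] with y hy
      simp only [dif_pos hy]
    · refine continuousAt_id.congr ?_
      filter_upwards [hn] with y hy
      simp only [dif_pos hy]
      rfl

/-- The smooth structure for which the induced covering map `toTotal` to `P` is a local
diffeomorphism. -/
instance : ChartedSpace EP (InducedSpace B q) :=
  pullbackChartedSpace (toTotal (B := B) (q := q)) isLocalHomeomorph_toTotal

instance : IsManifold 𝓘(ℝ, EP) ∞ (InducedSpace B q) :=
  pullbackChartedSpace_isManifold (toTotal (B := B) (q := q)) isLocalHomeomorph_toTotal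

theorem isLocalDiffeomorph_toTotal :
    IsLocalDiffeomorph 𝓘(ℝ, EP) 𝓘(ℝ, EP) ∞ (toTotal (B := B) (q := q)) :=
  pullbackChartedSpace_isLocalDiffeomorph (toTotal (B := B) (q := q)) isLocalHomeomorph_toTotal

theorem contMDiff_toTotal : ContMDiff 𝓘(ℝ, EP) 𝓘(ℝ, EP) ∞ (toTotal (B := B) (q := q)) :=
  isLocalDiffeomorph_toTotal.contMDiff

open Classical in
/-- The section of the induced bundle given by a local section `s` of `P`; outside the preimage of
the domain of `s` the value is the irrelevant `z₀`. -/
def liftSection (z₀ : InducedSpace B q) (s : M → P) (m : M') : InducedSpace B q :=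
  if h : q.toFun m = B.proj (s (q.toFun m)) then ⟨m, s (q.toFun m), h⟩ else z₀

theorem proj_liftSection (z₀ : InducedSpace B q) {s : M → P} {m : M'}
    (h : B.proj (s (q.toFun m)) = q.toFun m) : proj (liftSection z₀ s m) = m := by
  simp only [liftSection, dif_pos h.symm]

theorem toTotal_liftSection (z₀ : InducedSpace B q) {s : M → P} {m : M'}
    (h : B.proj (s (q.toFun m)) = q.toFun m) :
    toTotal (liftSection z₀ s m) = s (q.toFun m) := by
  simp only [liftSection, dif_pos h.symm]

theorem contMDiffAt_liftSection (z₀ : InducedSpace B q) {s : M → P} {U : Set M} (hU : IsOpen U)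
    (hs : ContMDiffOn 𝓘(ℝ, EM) 𝓘(ℝ, EP) ∞ s U) (hp : ∀ m ∈ U, B.proj (s m) = m)
    {m : M'} (hm : q.toFun m ∈ U) :
    ContMDiffAt 𝓘(ℝ, EM) 𝓘(ℝ, EP) ∞ (liftSection z₀ s) m := by
  have hn : ∀ᶠ y in 𝓝 m, q.toFun y ∈ U :=
    q.isCoveringMap.continuous.continuousAt.eventually (hU.mem_nhds hm)
  have h1 : ContMDiffAt 𝓘(ℝ, EM) 𝓘(ℝ, EP) ∞ (fun y => s (q.toFun y)) m :=
    ContMDiffAt.comp m (hs.contMDiffAt (hU.mem_nhds hm)) (q.isLocalDiffeomorph.contMDiff m)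
  have h2 : (fun y => toTotal (liftSection z₀ s y)) =ᶠ[𝓝 m] fun y => s (q.toFun y) := by
    filter_upwards [hn] with y hy using toTotal_liftSection z₀ (hp _ hy)
  have h3 := h1.congr_of_eventuallyEq h2
  refine isLocalDiffeomorph_toTotal.contMDiffAt_of_comp (continuous_iff.2 ⟨?_, h3.continuousAt⟩) h3
  refine continuousAt_id.congr ?_
  filter_upwards [hn] with y hy using (proj_liftSection z₀ (hp _ hy)).symm

end InducedSpace

open InducedSpace

/-- The principal bundle induced over the covering manifold. -/
def PrincipalBundle.induced (B : PrincipalBundle EM EG EP M G P) (q : SmoothCovering EM M M') :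
    PrincipalBundle EM EG EP M' G (InducedSpace B q) where
  proj := InducedSpace.proj
  contMDiff_proj z := by
    refine q.isLocalDiffeomorph.contMDiffAt_of_comp continuous_proj.continuousAt ?_
    have h : q.toFun ∘ InducedSpace.proj = B.proj ∘ toTotal := funext toFun_proj
    rw [h]
    exact (B.contMDiff_proj.comp contMDiff_toTotal) z
  contMDiff_smul z := by
    have h : ContMDiff (𝓘(ℝ, EG).prod 𝓘(ℝ, EP)) 𝓘(ℝ, EP) ∞
        (fun z : G × InducedSpace B q => z.1 • toTotal z.2) :=
      B.contMDiff_smul.comp (contMDiff_fst.prodMk (contMDiff_toTotal.comp contMDiff_snd))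
    refine isLocalDiffeomorph_toTotal.contMDiffAt_of_comp (continuous_iff.2 ⟨?_, ?_⟩) (h z)
    · exact (continuous_proj.comp continuous_snd).continuousAt
    · exact (h z).continuousAt
  proj_smul _ _ := rfl
  locally_trivial m := by
    obtain ⟨U, s, τ, hU, hm, hs, hτ, h1, h2, h3⟩ := B.locally_trivial (q.toFun m)
    let z₀ : InducedSpace B q := ⟨m, s (q.toFun m), (h1 _ hm).symm⟩
    refine ⟨q.toFun ⁻¹' U, liftSection z₀ s, fun z => τ (toTotal z),
      hU.preimage q.isCoveringMap.continuous, hm, ?_, ?_, ?_, ?_, ?_⟩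
    · exact fun y hy => (contMDiffAt_liftSection z₀ hU hs h1 hy).contMDiffWithinAt
    · refine hτ.comp contMDiff_toTotal.contMDiffOn fun z hz => ?_
      have hz' : q.toFun (z.proj) ∈ U := hz
      rw [toFun_proj] at hz'
      exact hz'
    · exact fun y hy => proj_liftSection z₀ (h1 _ hy)
    · intro z hz
      have hz' : q.toFun (z.proj) ∈ U := hz
      refine InducedSpace.ext (proj_liftSection z₀ (h1 _ hz')) ?_
      change τ (toTotal z) • toTotal (liftSection z₀ s (z.proj)) =
        toTotal z
      rw [toTotal_liftSection z₀ (h1 _ hz'), toFun_proj]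
      rw [toFun_proj] at hz'
      exact h2 _ hz'
    · intro y hy g
      change τ (g • toTotal (liftSection z₀ s y)) = g
      rw [toTotal_liftSection z₀ (h1 _ hy)]
      exact h3 _ hy g

/-- The induced connection: the pullback of the connection form along the induced covering map
of total spaces. -/
def Connection.induced (θ : Connection B) (q : SmoothCovering EM M M') :
    Connection (B.induced q) where
  form z := (θ.form (toTotal z)).comp (mfderiv 𝓘(ℝ, EP) 𝓘(ℝ, EP) (toTotal (B := B) (q := q)) z)
  contMDiff_form :=
    θ.contMDiff_form.comp (contMDiff_toTotal.contMDiff_tangentMap (m := ∞) (by simp))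
  form_fundamental z A := by
    have h1 : MDifferentiableAt 𝓘(ℝ, EG) 𝓘(ℝ, EP) (fun g : G => g • z) 1 :=
      (B.induced q).contMDiff_smul_const z |>.mdifferentiable (by simp) 1
    have h2 : MDifferentiableAt 𝓘(ℝ, EP) 𝓘(ℝ, EP) (toTotal (B := B) (q := q)) ((1 : G) • z) :=
      contMDiff_toTotal.mdifferentiable (by simp) _
    have h3 := mfderiv_comp_apply (1 : G) h2 h1 A
    have key : ∀ z' : InducedSpace B q, z' = z → ∀ v : EP,
        mfderiv 𝓘(ℝ, EP) 𝓘(ℝ, EP) (toTotal (B := B) (q := q)) z' v =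
        (mfderiv 𝓘(ℝ, EP) 𝓘(ℝ, EP) (toTotal (B := B) (q := q)) z : EP →L[ℝ] EP) v := by
      rintro _ rfl v; rfl
    have h4 := h3.trans (key _ (one_smul G z) _)
    exact (congrArg (θ.form (toTotal z)) h4).symm.trans (θ.form_fundamental (toTotal z) A)
  form_smul g z v := by
    have h1 : MDifferentiableAt 𝓘(ℝ, EP) 𝓘(ℝ, EP) (fun y : InducedSpace B q => g • y) z :=
      (B.induced q).contMDiff_const_smul g |>.mdifferentiable (by simp) z
    have h2 : MDifferentiableAt 𝓘(ℝ, EP) 𝓘(ℝ, EP) (toTotal (B := B) (q := q)) (g • z) :=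
      contMDiff_toTotal.mdifferentiable (by simp) _
    have h3 := mfderiv_comp_apply z h2 h1 v
    have h1' : MDifferentiableAt 𝓘(ℝ, EP) 𝓘(ℝ, EP) (fun y : P => g • y) (toTotal z) :=
      B.contMDiff_const_smul g |>.mdifferentiable (by simp) _
    have h2' : MDifferentiableAt 𝓘(ℝ, EP) 𝓘(ℝ, EP) (toTotal (B := B) (q := q)) z :=
      contMDiff_toTotal.mdifferentiable (by simp) _
    have h3' := mfderiv_comp_apply z h1' h2' v
    have h4 := h3.symm.trans h3'
    exact (congrArg (θ.form (g • toTotal z)) h4).trans (θ.form_smul g (toTotal z) _)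

theorem Connection.IsHorizontalSection.induced {θ : Connection B} {V : Set M} {σ : M → P}
    (h : θ.IsHorizontalSection V σ) (q : SmoothCovering EM M M') (z₀ : InducedSpace B q) :
    (θ.induced q).IsHorizontalSection (q.toFun ⁻¹' V) (liftSection z₀ σ) where
  isOpen := h.isOpen.preimage q.isCoveringMap.continuous
  contMDiffOn y hy :=
    (contMDiffAt_liftSection z₀ h.isOpen h.contMDiffOn h.proj_eq hy).contMDiffWithinAt
  proj_eq y hy := proj_liftSection z₀ (h.proj_eq _ hy)
  horizontal y hy v := by
    have hs := contMDiffAt_liftSection z₀ h.isOpen h.contMDiffOn h.proj_eq hy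
    have h1 : MDifferentiableAt 𝓘(ℝ, EM) 𝓘(ℝ, EP) (liftSection z₀ σ) y :=
      hs.mdifferentiableAt (by simp)
    have h2 : MDifferentiableAt 𝓘(ℝ, EP) 𝓘(ℝ, EP) (toTotal (B := B) (q := q)) (liftSection z₀ σ y) :=
      contMDiff_toTotal.mdifferentiable (by simp) _
    have h3 := mfderiv_comp_apply y h2 h1 v
    have heq : toTotal ∘ liftSection z₀ σ =ᶠ[𝓝 y] σ ∘ q.toFun := by
      filter_upwards [(h.isOpen.preimage q.isCoveringMap.continuous).mem_nhds hy] with x hx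
      exact toTotal_liftSection z₀ (h.proj_eq _ hx)
    have h4 : MDifferentiableAt 𝓘(ℝ, EM) 𝓘(ℝ, EP) σ (q.toFun y) :=
      (h.contMDiffOn.contMDiffAt (h.isOpen.mem_nhds hy)).mdifferentiableAt (by simp)
    have h5 : MDifferentiableAt 𝓘(ℝ, EM) 𝓘(ℝ, EM) q.toFun y :=
      q.isLocalDiffeomorph.contMDiff.mdifferentiable (by simp) _
    have h6 := mfderiv_comp_apply y h4 h5 v
    have key : ∀ x : P, x = σ (q.toFun y) → ∀ w : EM,
        θ.form x (mfderiv 𝓘(ℝ, EM) 𝓘(ℝ, EP) σ (q.toFun y) w : EP) = 0 := by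
      rintro _ rfl w
      exact h.horizontal _ hy w
    rw [heq.mfderiv_eq] at h3
    have h7 := h3.symm.trans h6
    exact (congrArg (θ.form (toTotal (liftSection z₀ σ y))) h7).trans
      (key _ (toTotal_liftSection z₀ (h.proj_eq _ hy)) _)

/-- The connection induced by a flat connection over a covering manifold is flat. -/
def FlatConnection.induced (θ : FlatConnection B) (q : SmoothCovering EM M M') :
    FlatConnection (B.induced q) where
  toConnection := θ.toConnection.induced q
  flat m := by
    obtain ⟨V, σ, hm, hσ⟩ := θ.flat (q.toFun m)
    let z₀ : InducedSpace B q := ⟨m, σ (q.toFun m), (hσ.proj_eq _ hm).symm⟩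
    exact ⟨_, _, hm, hσ.induced q z₀⟩

/-- The morphism `q_# : π₁(M', m') → π₁(M, m)` of fundamental groups induced by the covering, for
`m = q m'`; its range is `π₁(M')` regarded as a subgroup of `π₁(M)`. -/
def SmoothCovering.fundamentalGroupMap (q : SmoothCovering EM M M') {m' : M'} {m : M}
    (h : q.toFun m' = m) : FundamentalGroup M' m' →* FundamentalGroup M m :=
  FundamentalGroup.mapOfEq ⟨q.toFun, q.isCoveringMap.continuous⟩ h

end Lemmas

end

end FlatBundle

/-! With their leaf topologies, the total spaces of the two bundles are covering spaces of `M` and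
of `M'`, and the map of total spaces, called `leafMap`, makes a commutative square with these two
coverings and with `q`. A leaf is a path component of such a covering space, so the statement
reduces to lifting paths around the square.

The other three sides of the square are local diffeomorphisms. Hence `leafMap` is a local
homeomorphism and smooth, and once it is bijective between leaves its inverse is smooth as well. It
maps a leaf into a leaf because it is continuous.

Surjectivity (`exists_leafMap_eq`): project a path in the leaf of `x₀` to `M`, lift it to `M'`
through `q`, then lift it to the induced leaf. By uniqueness of lifts its image is the path one
started from. This needs no assumption on the holonomy.

Injectivity (`injOn_leafMap`) is where the kernel condition enters. If `y` and `z` in the leaf of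
`y₀` have the same image, project paths from `y₀` to `y` and to `z` down to classes `c` and `d` in
`M`. The loop `c` followed by the reverse of `d` has a closed horizontal lift at `x₀`, so it lies in
the kernel of the holonomy, hence in the image of the fundamental group of `M'`, hence its lift to
`M'` closes up. So `c` and `d` lift to paths in `M'` with a common end point, which means that `y`
and `z` lie over the same point of `M'`. They also have the same image in `P`, and a point of the
fibre product is determined by these two components. -/

/-! ### Monodromy of a single covering -/

/-- A loop in the base that lifts to a loop acts trivially on its base point. -/
theorem IsCoveringMap.monodromy_eq_self_of_mem_range {E X : Type*} [TopologicalSpace E]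
    [TopologicalSpace X] {p : E → X} (cov : IsCoveringMap p) {x : X} {e : E} (he : p e = x)
    {γ : FundamentalGroup X x}
    (h : γ ∈ (FundamentalGroup.mapOfEq ⟨p, cov.continuous⟩ he).range) :
    cov.monodromy γ ⟨e, he⟩ = ⟨e, he⟩ := by
  obtain ⟨γ, rfl⟩ := h
  refine cov.monodromy_eq_of_map_eq γ ?_
  -- `mapOfEq` transports the end points along `he`, and the fibre point `⟨e, he⟩` asks for the
  -- transport back; the two cancel.
  rw [FundamentalGroup.mapOfEq_apply]
  exact ((Path.Homotopic.Quotient.cast_cast _ _ _ _ _).trans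
    (Path.Homotopic.Quotient.cast_rfl_rfl _)).symm

theorem IsCoveringMap.monodromy_symm_apply {E X : Type*} [TopologicalSpace E]
    [TopologicalSpace X] {p : E → X} (cov : IsCoveringMap p) {x y : X}
    (γ : Path.Homotopic.Quotient x y) (e : p ⁻¹' {x}) :
    cov.monodromy γ.symm (cov.monodromy γ e) = e := by
  rw [← cov.monodromy_trans_apply, Path.Homotopic.Quotient.trans_symm, cov.monodromy_refl, id]

/-! ### Path lifting in a commutative square of coverings -/

section CoveringSquare

variable {E E' X Y : Type*} [TopologicalSpace E] [TopologicalSpace E'] [TopologicalSpace X]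
  [TopologicalSpace Y] {p : E → X} {q : Y → X} {p' : E' → Y} {T : E' → E}

/-- In a commutative square `p ∘ T = q ∘ p'` with `p` and `q` covering maps, a path in `E'`
projects to a homotopy class in the base whose monodromies transport both of its images. -/
theorem Joined.exists_monodromy_eq (hp : IsCoveringMap p) (hq : IsCoveringMap q)
    (hT : Continuous T) (hp' : Continuous p') (hsq : ∀ z, p (T z) = q (p' z)) {y z : E'}
    (h : Joined y z) {a b : X} (ha : p (T y) = a) (hb : p (T z) = b) :
    ∃ c : Path.Homotopic.Quotient a b,
      hp.monodromy c ⟨T y, ha⟩ = ⟨T z, hb⟩ ∧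
      hq.monodromy c ⟨p' y, (hsq y).symm.trans ha⟩ = ⟨p' z, (hsq z).symm.trans hb⟩ := by
  subst ha hb
  obtain ⟨γ⟩ := h
  -- The class of `p ∘ T ∘ γ`, which equals `q ∘ p' ∘ γ` by commutativity: its lift through `p` is
  -- `T ∘ γ` and its lift through `q` is `p' ∘ γ`.
  refine ⟨.mk ((γ.map hT).map hp.continuous), ?_, ?_⟩
  · exact hp.monodromy_map (.mk (γ.map hT))
  · refine hq.monodromy_eq_of_map_eq (.mk (γ.map hp')) ?_
    refine congrArg Path.Homotopic.Quotient.mk ?_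
    ext t
    exact (hsq (γ t)).symm

/-- Paths in `E` from `T y` lift through a commutative square of covering maps. -/
theorem Joined.exists_joined_of_covering_square (hp : IsCoveringMap p) (hq : IsCoveringMap q)
    (hT : Continuous T) (hp' : IsCoveringMap p') (hsq : ∀ z, p (T z) = q (p' z)) {y : E'} {x : E}
    (h : Joined (T y) x) : ∃ z, Joined y z ∧ T z = x := by
  obtain ⟨γ⟩ := h
  -- Go around the square: `δ` lifts `p ∘ γ` to `Y` from `p' y`, then `ε` lifts `δ` to `E'` from
  -- `y`.
  obtain ⟨δ, hδ, hδ0⟩ := hq.exists_path_lifts ((γ.map hp.continuous) : C(unitInterval, X)) (p' y)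
    (by simp [hsq])
  obtain ⟨ε, hε, hε0⟩ := hp'.exists_path_lifts δ y hδ0
  -- Both are lifts of the same path through `p`, and both start at `T y`.
  have key : T ∘ ε = γ := by
    refine hp.eq_of_comp_eq (hT.comp ε.continuous) γ.continuous ?_ 0 (by simp [hε0])
    funext t
    have h1 := congrFun hε t
    have h2 := congrFun hδ t
    simp only [Function.comp_apply] at h1 h2 ⊢
    rw [hsq, h1, h2]
    rfl
  refine ⟨ε 1, ⟨⟨ε, hε0, rfl⟩⟩, ?_⟩
  simpa using congrFun key 1

end CoveringSquare

theorem IsLocalDiffeomorph.comp_of_isLocalDiffeomorph {X Y Z E : Type*} [TopologicalSpace X]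
    [TopologicalSpace Y] [TopologicalSpace Z] [NormedAddCommGroup E] [NormedSpace ℝ E]
    [ChartedSpace E X] [ChartedSpace E Y] [ChartedSpace E Z] {g : Y → Z} {f : X → Y}
    (hg : IsLocalDiffeomorph 𝓘(ℝ, E) 𝓘(ℝ, E) ∞ g) (hf : IsLocalDiffeomorph 𝓘(ℝ, E) 𝓘(ℝ, E) ∞ f) :
    IsLocalDiffeomorph 𝓘(ℝ, E) 𝓘(ℝ, E) ∞ (g ∘ f) :=
  fun x => (hf x).comp _ _ (hg (f x))

/-! ### The map between leaf spaces over a covering -/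

namespace FlatBundle

section LeafMap

variable {EM EG EP : Type*}
  [NormedAddCommGroup EM] [NormedSpace ℝ EM]
  [NormedAddCommGroup EG] [NormedSpace ℝ EG]
  [NormedAddCommGroup EP] [NormedSpace ℝ EP]
  {M G P M' : Type*}
  [TopologicalSpace M] [ChartedSpace EM M] [IsManifold 𝓘(ℝ, EM) ∞ M]
  [TopologicalSpace G] [ChartedSpace EG G] [Group G] [LieGroup 𝓘(ℝ, EG) ∞ G]
  [TopologicalSpace P] [ChartedSpace EP P] [IsManifold 𝓘(ℝ, EP) ∞ P] [MulAction G P]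
  [TopologicalSpace M'] [ChartedSpace EM M'] [IsManifold 𝓘(ℝ, EM) ∞ M']
  {B : PrincipalBundle EM EG EP M G P}

/-- The map of total spaces over a covering, as a map of leaf spaces. -/
def leafMap (θ : FlatConnection B) (q : SmoothCovering EM M M') :
    LeafSpace (θ.induced q) → LeafSpace θ :=
  (InducedSpace.toTotal : InducedSpace B q → P)

variable (θ : FlatConnection B) (q : SmoothCovering EM M M')

theorem proj_leafMap (z : LeafSpace (θ.induced q)) :
    LeafSpace.proj θ (leafMap θ q z) = q.toFun (LeafSpace.proj (θ.induced q) z) :=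
  (InducedSpace.toFun_proj (B := B) (q := q) z).symm

/-- Continuity of the map for the manifold topologies would not suffice, since the leaf topology on
the target is finer. A horizontal section `σ` through the image of `z` lifts to a horizontal section
through `z`, and on the plaque of the lift the map is `σ ∘ q ∘ proj`, where `σ` is continuous into
the leaf topology. -/
theorem continuous_leafMap : Continuous (leafMap θ q) := by
  rw [continuous_iff_continuousAt]
  intro z
  obtain ⟨V, σ, hm, hσz, hσ⟩ := θ.exists_section (leafMap θ q z)
  have hqz : B.proj (leafMap θ q z) = q.toFun (LeafSpace.proj (θ.induced q) z) :=
    proj_leafMap θ q z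
  -- Here `z` is only the default value of `liftSection`; no value of `S` outside `q.toFun ⁻¹' V` is
  -- used.
  let S := InducedSpace.liftSection (B := B) (q := q) z σ
  have hS : (θ.induced q).IsHorizontalSection (q.toFun ⁻¹' V) S := hσ.induced q z
  have hmem : z ∈ S '' (q.toFun ⁻¹' V) := by
    have hV : q.toFun (LeafSpace.proj (θ.induced q) z) ∈ V := hqz ▸ hm
    refine ⟨LeafSpace.proj (θ.induced q) z, hV, ?_⟩
    refine InducedSpace.ext (InducedSpace.proj_liftSection (B := B) z (hσ.proj_eq _ hV)) ?_
    refine (InducedSpace.toTotal_liftSection (B := B) z (hσ.proj_eq _ hV)).trans ?_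
    rw [← hqz]
    exact hσz
  have hc : ContinuousAt (Y := LeafSpace θ)
      (fun w => σ (q.toFun (LeafSpace.proj (θ.induced q) w))) z := by
    have h1 : ContinuousAt (Y := LeafSpace θ) σ (q.toFun (LeafSpace.proj (θ.induced q) z)) :=
      (LeafSpace.continuousOn_section hσ).continuousAt (hσ.isOpen.mem_nhds (hqz ▸ hm))
    exact ContinuousAt.comp (Y := M) (Z := LeafSpace θ) h1
      (q.isCoveringMap.continuous.comp LeafSpace.continuous_proj).continuousAt
  refine hc.congr ?_
  filter_upwards [(LeafSpace.isOpen_plaque hS).mem_nhds hmem]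
  rintro _ ⟨m, hmV, rfl⟩
  have h1 := InducedSpace.proj_liftSection (B := B) z (hσ.proj_eq (q.toFun m) hmV)
  have h2 := InducedSpace.toTotal_liftSection (B := B) z (hσ.proj_eq (q.toFun m) hmV)
  exact (congrArg (fun w => σ (q.toFun w)) h1).trans h2.symm

/-- Local homeomorphisms cancel on the left: composing with the projection to `M` gives `q` after
the projection to `M'`, a composite of local homeomorphisms. -/
theorem isLocalHomeomorph_leafMap : IsLocalHomeomorph (leafMap θ q) := by
  refine IsLocalHomeomorph.of_comp ?_ (LeafSpace.isLocalHomeomorph_proj (θ := θ))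
    (continuous_leafMap θ q)
  have h : LeafSpace.proj θ ∘ leafMap θ q = q.toFun ∘ LeafSpace.proj (θ.induced q) :=
    funext (proj_leafMap θ q)
  rw [h]
  exact q.isCoveringMap.isLocalHomeomorph.comp LeafSpace.isLocalHomeomorph_proj

theorem LeafSpace.isLocalDiffeomorph_proj :
    IsLocalDiffeomorph 𝓘(ℝ, EM) 𝓘(ℝ, EM) ∞ (LeafSpace.proj θ) :=
  pullbackChartedSpace_isLocalDiffeomorph _ _

/-- The projection of the leaf space to `M` is a local diffeomorphism, so smoothness of a continuous
map can be tested after composing with it. -/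
theorem contMDiff_leafMap : ContMDiff 𝓘(ℝ, EM) 𝓘(ℝ, EM) ∞ (leafMap θ q) := by
  intro z
  refine (LeafSpace.isLocalDiffeomorph_proj θ).contMDiffAt_of_comp
    (continuous_leafMap θ q).continuousAt ?_
  have h : LeafSpace.proj θ ∘ leafMap θ q = q.toFun ∘ LeafSpace.proj (θ.induced q) :=
    funext (proj_leafMap θ q)
  rw [h]
  exact (q.isLocalDiffeomorph.comp_of_isLocalDiffeomorph
    (LeafSpace.isLocalDiffeomorph_proj (θ.induced q))).contMDiff z

variable {θ q}

theorem leafMap_mem_leaf {y₀ z : InducedSpace B q} (hz : z ∈ (θ.induced q).leaf y₀) :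
    leafMap θ q z ∈ θ.leaf y₀.toTotal :=
  Joined.map (X := LeafSpace (θ.induced q)) (Y := LeafSpace θ) hz (continuous_leafMap θ q)

theorem exists_leafMap_eq {y₀ : InducedSpace B q} {x : LeafSpace θ}
    (hx : x ∈ θ.leaf y₀.toTotal) : ∃ z ∈ (θ.induced q).leaf y₀, leafMap θ q z = x :=
  Joined.exists_joined_of_covering_square (T := leafMap θ q) (y := y₀)
    (LeafSpace.isQuotientCoveringMap_proj (θ := θ)).isCoveringMap
    q.isCoveringMap (continuous_leafMap θ q)
    (LeafSpace.isQuotientCoveringMap_proj (θ := θ.induced q)).isCoveringMap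
    (proj_leafMap θ q) hx

/-- If the kernel of the holonomy lies in the fundamental group of the covering manifold, then the
map of leaf spaces is injective on leaves. -/
theorem injOn_leafMap {y₀ : InducedSpace B q}
    (hker : (θ.holonomy y₀.toTotal).ker ≤ (q.fundamentalGroupMap y₀.toFun_proj).range) :
    Set.InjOn (leafMap θ q) ((θ.induced q).leaf y₀) := by
  intro y hy z hz hyz
  have hp := LeafSpace.isQuotientCoveringMap_proj (θ := θ)
  have hp' : Continuous (LeafSpace.proj (θ.induced q)) := LeafSpace.continuous_proj
  obtain ⟨c, hc1, hc2⟩ := Joined.exists_monodromy_eq (y := y₀) (z := y) hp.isCoveringMap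
    q.isCoveringMap (continuous_leafMap θ q) hp' (proj_leafMap θ q) hy rfl rfl
  -- The end point of `d` is expressed through the image of `y`, by `hyz`, so that `c` and `d` have
  -- the same end points and `c.trans d.symm` is a loop.
  obtain ⟨d, hd1, hd2⟩ := Joined.exists_monodromy_eq (y := y₀) (z := z) hp.isCoveringMap
    q.isCoveringMap (continuous_leafMap θ q) hp' (proj_leafMap θ q) hz rfl
    (congrArg (LeafSpace.proj θ) hyz.symm)
  have hloop : hp.isCoveringMap.monodromy (c.trans d.symm) ⟨leafMap θ q y₀, rfl⟩ =
      ⟨leafMap θ q y₀, rfl⟩ := by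
    rw [hp.isCoveringMap.monodromy_trans_apply, hc1]
    have : (⟨leafMap θ q y, rfl⟩ : LeafSpace.proj θ ⁻¹' {LeafSpace.proj θ (leafMap θ q y)}) =
        hp.isCoveringMap.monodromy d ⟨leafMap θ q y₀, rfl⟩ := by
      rw [hd1]; exact Subtype.ext hyz
    rw [this, hp.isCoveringMap.monodromy_symm_apply]
  -- The holonomy of a loop is trivial exactly when its monodromy fixes the base point of the fibre.
  have hmem : (c.trans d.symm : FundamentalGroup M (B.proj y₀.toTotal)) ∈
      (θ.holonomy y₀.toTotal).ker :=
    hp.fundamentalGroupToMulOpposite_eq_one_iff.2 hloop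
  have hfix := q.isCoveringMap.monodromy_eq_self_of_mem_range
    y₀.toFun_proj (hker hmem)
  -- In the fibres of `q`, transport along the reverse of `d` takes the end points of the lifts of
  -- `c` and of `d` to the same point, the projection of `y₀`. This transport is injective, so the
  -- end points agree.
  have hproj : LeafSpace.proj (θ.induced q) y = LeafSpace.proj (θ.induced q) z := by
    have h1 := q.isCoveringMap.monodromy_trans_apply c d.symm
      ⟨InducedSpace.proj y₀, y₀.toFun_proj⟩
    have h2 := q.isCoveringMap.monodromy_symm_apply d ⟨InducedSpace.proj y₀, y₀.toFun_proj⟩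
    have h3 := (q.isCoveringMap.monodromy_bijective d.symm).injective
      (h1.symm.trans (hfix.trans h2.symm))
    exact congrArg Subtype.val (hc2.symm.trans (h3.trans hd2))
  exact InducedSpace.ext hproj hyz

end LeafMap

end FlatBundle

/-! ### The diffeomorphism of leaves -/

theorem corollary2p2
    {EM EG EP : Type*}
    [NormedAddCommGroup EM] [NormedSpace ℝ EM] [FiniteDimensional ℝ EM]
    [NormedAddCommGroup EG] [NormedSpace ℝ EG] [FiniteDimensional ℝ EG]
    [NormedAddCommGroup EP] [NormedSpace ℝ EP] [FiniteDimensional ℝ EP]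
    {M G P M' : Type*}
    [TopologicalSpace M] [ChartedSpace EM M] [IsManifold 𝓘(ℝ, EM) ∞ M]
    [T2Space M] [ParacompactSpace M] [ConnectedSpace M]
    [TopologicalSpace G] [ChartedSpace EG G] [Group G] [LieGroup 𝓘(ℝ, EG) ∞ G]
    [TopologicalSpace P] [ChartedSpace EP P] [IsManifold 𝓘(ℝ, EP) ∞ P]
    [T2Space P] [ParacompactSpace P] [ConnectedSpace P] [MulAction G P]
    [TopologicalSpace M'] [ChartedSpace EM M'] [IsManifold 𝓘(ℝ, EM) ∞ M'] [ConnectedSpace M']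
    (B : FlatBundle.PrincipalBundle EM EG EP M G P)
    (θ : FlatBundle.FlatConnection B)
    (q : FlatBundle.SmoothCovering EM M M')
    (x₀ : P) (y₀ : FlatBundle.InducedSpace B q) (hy₀ : y₀.toTotal = x₀)
    (hker : (θ.holonomy x₀).ker ≤
      (q.fundamentalGroupMap (y₀.toFun_proj.trans (congrArg B.proj hy₀))).range) :
    ∃ Φ : Diffeomorph 𝓘(ℝ, EM) 𝓘(ℝ, EM) ((θ.induced q).leaf y₀) (θ.leaf x₀) ∞,
      ∀ y : (θ.induced q).leaf y₀,
        ((Φ y : FlatBundle.LeafSpace θ) : P) =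
          ((y : FlatBundle.LeafSpace (θ.induced q)) : FlatBundle.InducedSpace B q).toTotal := by
  subst hy₀
  let F : (θ.induced q).leaf y₀ → θ.leaf y₀.toTotal := fun y =>
    ⟨FlatBundle.leafMap θ q y, FlatBundle.leafMap_mem_leaf y.2⟩
  have hval : Subtype.val ∘ F = FlatBundle.leafMap θ q ∘ Subtype.val := rfl
  have hinj : Function.Injective (FlatBundle.leafMap θ q ∘
      (Subtype.val : (θ.induced q).leaf y₀ → _)) := fun y z h =>
    Subtype.ext (FlatBundle.injOn_leafMap hker y.2 z.2 h)
  -- An injective local homeomorphism is an open embedding. This is applied to the map into the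
  -- whole leaf space and then restricted to the target leaf, which is open there.
  have hemb : Topology.IsOpenEmbedding F :=
    .of_comp F (θ.leaf y₀.toTotal).isOpenEmbedding'
      (((FlatBundle.isLocalHomeomorph_leafMap θ q).comp
        ((θ.induced q).leaf y₀).isOpenEmbedding'.isLocalHomeomorph).isOpenEmbedding_of_injective
          hinj)
  have hsurj : Function.Surjective F := fun x => by
    obtain ⟨z, hz, hzx⟩ := FlatBundle.exists_leafMap_eq (q := q) x.2
    exact ⟨⟨z, hz⟩, Subtype.ext hzx⟩
  let Φ := hemb.isEmbedding.toHomeomorphOfSurjective hsurj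
  refine ⟨⟨Φ.toEquiv, ?_, ?_⟩, fun y => rfl⟩
  · refine (ContMDiff.subtypeVal_comp_iff _ _).1 ?_
    exact (FlatBundle.contMDiff_leafMap θ q).comp contMDiff_subtype_val
  -- Smoothness of the inverse is tested after the local diffeomorphism from the induced leaf space
  -- down to `M`. By commutativity of the square the composite is just the projection of the leaf of
  -- `x₀` to `M`, which is smooth.
  · refine (ContMDiff.subtypeVal_comp_iff _ _).1 fun x => ?_
    refine (q.isLocalDiffeomorph.comp_of_isLocalDiffeomorph
      (FlatBundle.LeafSpace.isLocalDiffeomorph_proj (θ.induced q))).contMDiffAt_of_comp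
      (continuous_subtype_val.comp Φ.symm.continuous).continuousAt ?_
    have h : (q.toFun ∘ FlatBundle.LeafSpace.proj (θ.induced q)) ∘ Subtype.val ∘ Φ.symm =
        FlatBundle.LeafSpace.proj θ ∘ Subtype.val := by
      funext x
      refine (FlatBundle.proj_leafMap θ q _).symm.trans ?_
      exact congrArg (fun w : θ.leaf y₀.toTotal => FlatBundle.LeafSpace.proj θ w)
        (Φ.apply_symm_apply x)
    exact h ▸ ((FlatBundle.LeafSpace.isLocalDiffeomorph_proj θ).contMDiff.comp
      contMDiff_subtype_val) x
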